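/- **Setting.** Fix $\alpha\in(0,1)$ and an integer $N\ge 0$. Let $\Omega\subset\mathbb R^3$ be a bounded domain with boundary $\Gamma$ of class $C^{N+2,\alpha}$ and outward unit normal $\boldsymbol n$, where $\Gamma$ is the disjoint union of $\Gamma_+$, $\Gamma_-$, $\Gamma_0$, each a finite (possibly empty) union of components of $\Gamma$. For a vector field $\mathbf v$ on $\Gamma$ write $v^{\boldsymbol n}=\mathbf v\cdot\boldsymbol n$, $\mathbf v^{\boldsymbol\tau}=\mathbf v-v^{\boldsymbol n}\boldsymbol n$, and $\mathbf v^\perp=\boldsymbol n\times\mathbf v$ for tangential $\mathbf v$; let $\nabla_\Gamma$ be the surface gradient on $\Gamma$. Let $\mathcal U\in C^{N+2,\alpha}([0,\infty)\times\Omega)$ be a divergence-free vector field whose normal component $U^{\boldsymbol n}=\mathcal U\cdot\boldsymbol n$ is $<0$ on $\Gamma_+$, $>0$ on $\Gamma_-$ and $=0$ on $\Gamma_0$ for all times. Let $H$ be the space of divergence-free $L^2$ fields on $\Omega$ tangent to $\Gamma$, and $H_0$ the $L^2$-orthogonal complement in $H$ of its curl-free members. Let $\mathbf f\in C^{\max\{N,1\},\alpha}([0,\infty)\times\Omega)\cap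 C([0,\infty);H_0)$, and let $\mathbf u_0\in C^{N+1,\alpha}(\Omega)$ be divergence-free with $\mathbf u_0\cdot\boldsymbol n=U^{\boldsymbol n}(0)$ on $\Gamma$ and $\mathbf u_0^{\boldsymbol\tau}=\mathcal U^{\boldsymbol\tau}(0)$ on $\Gamma_+$. Let $\partial_t^j\mathbf u|_{0}$ and $\partial_t^jp|_{0}$, $0\le j\le N$, denote the formal time derivatives at $t=0$ determined by the data as follows: $\partial_t^0\mathbf u|_0=\mathbf u_0$; $\partial_t^jp|_0\in C^{N+1-j,\alpha}(\Omega)\cap C^2(\Omega)$ is the mean-zero solution of the $j$-th time derivative (expanded by the Leibniz rule) at $t=0$ of $$\Delta p=-\nabla\mathbf u\cdot(\nabla\mathbf u)^T\ \text{in }\Omega,\qquad \nabla p\cdot\boldsymbol n=-\partial_tU^{\boldsymbol n}-(\mathbf u\cdot\nabla\mathbf u)\cdot\boldsymbol n\ \text{on }\Gamma;$$ and $\partial_t^{j+1}\mathbf u|_0=\partial_t^j[-\mathbf u\cdot\nabla\mathbf u-\nabla p+\mathbf f]_{t=0}$ for $j<N$. Put $\partial_t^j\boldsymbol\omega|_0=\operatorname{curl}\,\partial_t^j\mathbf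 u|_0$. The compatibility condition $\mathrm{cond}_N$ is: $\mathrm{cond}_{N-1}$ holds ($\mathrm{cond}_{-1}$ being vacuous) and $$\partial_t^{N+1}\mathcal U^{\boldsymbol\tau}|_{t=0}+\partial_t^N\big[\mathbf u\cdot\nabla\mathbf u+\nabla p-\mathbf f\big]^{\boldsymbol\tau}_{t=0}=0\quad\text{on }\Gamma_+ .$$ **Proposition.** Suppose that $\mathcal U^{\boldsymbol\tau}\equiv0$ on $[0,\infty)\times\Gamma_+$ and that $U^{\boldsymbol n}(t,\cdot)$ is constant along $\Gamma_+$ for each $t\ge 0$. Then $\mathrm{cond}_N$ holds if and only if, on $\Gamma_+$, $$\partial_t^j\mathbf f^{\boldsymbol\tau}|_{t=0}=\partial_t^j\nabla_\Gamma p|_{t=0}-\partial_t^j\big[U^{\boldsymbol n}(\boldsymbol\omega^{\boldsymbol\tau})^\perp\big]_{t=0}\quad\text{for all }0\le j\le N,$$ where $\partial_t^j[U^{\boldsymbol n}(\boldsymbol\omega^{\boldsymbol\tau})^\perp]_{t=0}=\sum_{i=0}^j\binom ji\,\partial_t^iU^{\boldsymbol n}|_{0}\,(\partial_t^{j-i}\boldsymbol\omega^{\boldsymbol\tau}|_0)^\perp$.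 In particular, if $\partial_t^iU^{\boldsymbol n}|_{t=0}=0$ on $\Gamma_+$ for $1\le i\le N$ (for instance if $N=0$, or if $U^{\boldsymbol n}$ is constant in time on $\Gamma_+$), then $\mathrm{cond}_N$ holds if and only if, on $\Gamma_+$, $$\partial_t^j\mathbf f^{\boldsymbol\tau}|_{t=0}=\partial_t^j\nabla_\Gamma p|_{t=0}-U_0^{\boldsymbol n}(\partial_t^j\boldsymbol\omega^{\boldsymbol\tau})^\perp|_{t=0}\quad\text{for all }0\le j\le N .$$ -/

import Mathlib

open Set MeasureTheory Filter Topology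
open scoped ContDiff RealInnerProductSpace

namespace EulerInflow

/-- Three-dimensional Euclidean space. -/
abbrev E3 : Type := EuclideanSpace ℝ (Fin 3)

/-- The standard basis vectors of `ℝ³`. -/
noncomputable def basisVec (i : Fin 3) : E3 := EuclideanSpace.single i (1 : ℝ)

/-- The cross product on `ℝ³`. -/
noncomputable def cross (a b : E3) : E3 := WithLp.toLp 2 (crossProduct a.ofLp b.ofLp)

/-- The tangential part `v - (v · ν) ν` of a vector `v` with respect to a unit vector `ν`. -/
noncomputable def tang (ν v : E3) : E3 := v - ⟪v, ν⟫ • ν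

/-- `v^⊥ = ν × v`: rotation of a tangent vector by 90 degrees counterclockwise about `ν`. -/
noncomputable def perp (ν v : E3) : E3 := cross ν v

/-! Spatial differential operators. In all of them `s` is the set on which the fields are
considered (the closure of the domain, so that values on the boundary are one-sided limits from
inside), and `∂ᵢ v` is the derivative within `s` in the direction of the `i`-th basis vector. -/

/-- The partial derivative `∂ᵢ v^k`. -/
noncomputable def pd (s : Set E3) (v : E3 → E3) (i k : Fin 3) (x : E3) : ℝ :=
  (fderivWithin ℝ v s x (basisVec i)) k

/-- The divergence of a vector field. -/
noncomputable def divg (s : Set E3) (v : E3 → E3) (x : E3) : ℝ :=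
  ∑ i : Fin 3, pd s v i i x

/-- The curl of a vector field. -/
noncomputable def curl (s : Set E3) (v : E3 → E3) (x : E3) : E3 :=
  !₂[pd s v 1 2 x - pd s v 2 1 x, pd s v 2 0 x - pd s v 0 2 x, pd s v 0 1 x - pd s v 1 0 x]

/-- The advection term `u · ∇ v`, with `k`-th component `∑ᵢ uⁱ ∂ᵢ v^k`. -/
noncomputable def adv (s : Set E3) (u v : E3 → E3) (x : E3) : E3 :=
  fderivWithin ℝ v s x (u x)

/-- The product `∇u · (∇v)ᵀ = ∑ᵢₖ ∂ᵢ u^k ∂ₖ vⁱ`. -/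
noncomputable def gradDot (s : Set E3) (u v : E3 → E3) (x : E3) : ℝ :=
  ∑ i : Fin 3, ∑ k : Fin 3, pd s u i k x * pd s v k i x

/-- The Hölder space `C^{k,α}(s)`: all derivatives up to order `k` are continuous and bounded on
`s`, and the derivatives of order `k` are Hölder continuous with exponent `α`. -/
def HolderOn {F G : Type*} [NormedAddCommGroup F] [NormedSpace ℝ F]
    [NormedAddCommGroup G] [NormedSpace ℝ G]
    (k : ℕ) (α : ℝ) (s : Set F) (g : F → G) : Prop :=
  ContDiffOn ℝ k g s ∧
  ∃ C : ℝ, (∀ j ≤ k, ∀ x ∈ s, ‖iteratedFDerivWithin ℝ j g s x‖ ≤ C) ∧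
    ∀ x ∈ s, ∀ y ∈ s,
      ‖iteratedFDerivWithin ℝ k g s x - iteratedFDerivWithin ℝ k g s y‖ ≤ C * ‖x - y‖ ^ α

/-- `ρ` is a `C¹` defining function of `Ω` in the open set `V`. -/
structure IsLocalDefiningFunction (Ω V : Set E3) (ρ : E3 → ℝ) : Prop where
  isOpen : IsOpen V
  contDiffOn : ContDiffOn ℝ 1 ρ V
  eq_neg : Ω ∩ V = {y ∈ V | ρ y < 0}
  grad_ne_zero : ∀ y ∈ V, gradient ρ y ≠ 0

/-- The boundary of `Ω` is of class `C^{k,α}`, with `Ω` locally on one side of it. -/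
def HasHolderBoundary (k : ℕ) (α : ℝ) (Ω : Set E3) : Prop :=
  ∀ x ∈ frontier Ω, ∃ (V : Set E3) (ρ : E3 → ℝ),
    x ∈ V ∧ IsLocalDefiningFunction Ω V ρ ∧ HolderOn k α V ρ

/-- `ν` is the outward unit normal to `Ω` at the boundary point `x`. -/
def IsOutwardUnitNormal (Ω : Set E3) (x ν : E3) : Prop :=
  ∃ (V : Set E3) (ρ : E3 → ℝ),
    x ∈ V ∧ IsLocalDefiningFunction Ω V ρ ∧ ν = ‖gradient ρ x‖⁻¹ • gradient ρ x

/-- `g` is the surface gradient at `x ∈ Γ` of the function `φ` on the surface `Γ` with unit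
normal `ν` at `x`: it is tangent to `Γ`, and the derivative of `φ` along any curve in `Γ` through
`x` is the inner product of `g` with the velocity of the curve. -/
def HasSurfaceGradient (Γ : Set E3) (ν : E3) (φ : E3 → ℝ) (x g : E3) : Prop :=
  ⟪g, ν⟫ = 0 ∧
  ∀ (c : ℝ → E3) (c' : E3), c 0 = x → (∀ᶠ s in 𝓝 0, c s ∈ Γ) → HasDerivAt c c' 0 →
    HasDerivAt (fun s => φ (c s)) ⟪g, c'⟫ 0

open Classical in
/-- The surface gradient `∇_Γ φ`. -/
noncomputable def surfaceGradient (Γ : Set E3) (ν : E3) (φ : E3 → ℝ) (x : E3) : E3 :=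
  if h : ∃ g, HasSurfaceGradient Γ ν φ x g then h.choose else 0

/-- The `j`-th (one-sided) time derivative at time zero of a function of `t ≥ 0`. -/
noncomputable def timeDeriv {G : Type*} [NormedAddCommGroup G] [NormedSpace ℝ G]
    (j : ℕ) (g : ℝ → G) : G :=
  iteratedDerivWithin j g (Ici 0) 0

/-- The space `H_c` of `L²` fields `v` on `Ω` with `div v = 0`, `v · n = 0` on the boundary
(both encoded by orthogonality to gradients), and `curl v = 0` in the sense of distributions. -/
def IsHarmonicField (Ω : Set E3) (v : E3 → E3) : Prop :=
  MemLp v 2 (volume.restrict Ω) ∧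
  (∀ φ : E3 → ℝ, ContDiff ℝ ∞ φ → HasCompactSupport φ →
    ∫ x in Ω, ⟪v x, gradient φ x⟫ = 0) ∧
  (∀ ψ : E3 → E3, ContDiff ℝ ∞ ψ → HasCompactSupport ψ → tsupport ψ ⊆ Ω →
    ∫ x in Ω, ⟪v x, curl univ ψ x⟫ = 0)

/-- Membership in `H_0`, the `L²`-orthogonal complement of `H_c` in the space of divergence-free
fields tangent to the boundary, for fields that are `C¹` up to the boundary. -/
structure IsH0Field (Ω : Set E3) (n : E3 → E3) (v : E3 → E3) : Prop where
  div_free : ∀ x ∈ Ω, divg (closure Ω) v x = 0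
  tangent : ∀ x ∈ frontier Ω, ⟪v x, n x⟫ = 0
  orthogonal : ∀ w : E3 → E3, IsHarmonicField Ω w → ∫ x in Ω, ⟪v x, w x⟫ = 0

/-- The geometric setting: a bounded domain with outward unit normal `n`, whose boundary is the
disjoint union of the inflow part `Γp`, the outflow part `Γm` and the impermeable part `Γ0`.
Since the three parts are closed, each is a union of (finitely many) connected components of the
boundary. -/
structure IsInflowDomain (Ω : Set E3) (n : E3 → E3) (Γp Γm Γ0 : Set E3) : Prop where
  isOpen : IsOpen Ω
  isConnected : IsConnected Ω
  isBounded : Bornology.IsBounded Ω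
  normal : ∀ x ∈ frontier Ω, IsOutwardUnitNormal Ω x (n x)
  union_eq : Γp ∪ Γm ∪ Γ0 = frontier Ω
  disjoint_pm : Disjoint Γp Γm
  disjoint_p0 : Disjoint Γp Γ0
  disjoint_m0 : Disjoint Γm Γ0
  isClosed_p : IsClosed Γp
  isClosed_m : IsClosed Γm
  isClosed_0 : IsClosed Γ0

/-- The normal boundary velocity `U^n = 𝒰 · n`. -/
noncomputable def normalVel (n : E3 → E3) (U : ℝ → E3 → E3) (t : ℝ) (x : E3) : ℝ :=
  ⟪U t x, n x⟫

/-- The data (domain, background field `U`, forcing `f`, initial velocity `u₀`) has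
regularity `N`. -/
structure HasRegularity (N : ℕ) (α : ℝ) (Ω : Set E3) (n : E3 → E3) (Γp Γm Γ0 : Set E3)
    (U f : ℝ → E3 → E3) (u₀ : E3 → E3) : Prop where
  domain : IsInflowDomain Ω n Γp Γm Γ0
  boundary : HasHolderBoundary (N + 2) α Ω
  U_holder : HolderOn (N + 2) α (Ici (0 : ℝ) ×ˢ closure Ω) (Function.uncurry U)
  U_div_free : ∀ t, 0 ≤ t → ∀ x ∈ Ω, divg (closure Ω) (U t) x = 0
  inflow : ∀ t, 0 ≤ t → ∀ x ∈ Γp, normalVel n U t x < 0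
  outflow : ∀ t, 0 ≤ t → ∀ x ∈ Γm, 0 < normalVel n U t x
  impermeable : ∀ t, 0 ≤ t → ∀ x ∈ Γ0, normalVel n U t x = 0
  f_holder : HolderOn (max N 1) α (Ici (0 : ℝ) ×ˢ closure Ω) (Function.uncurry f)
  f_H0 : ∀ t, 0 ≤ t → IsH0Field Ω n (f t)
  f_continuous : ∀ t₀, 0 ≤ t₀ → Tendsto
    (fun t => eLpNorm (fun x => f t x - f t₀ x) 2 (volume.restrict Ω)) (𝓝[Ici 0] t₀) (𝓝 0)
  u₀_holder : HolderOn (N + 1) α (closure Ω) u₀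
  u₀_div_free : ∀ x ∈ Ω, divg (closure Ω) u₀ x = 0
  u₀_normal : ∀ x ∈ frontier Ω, ⟪u₀ x, n x⟫ = normalVel n U 0 x
  u₀_tang : ∀ x ∈ Γp, tang (n x) (u₀ x) = tang (n x) (U 0 x)

/-- The value at time zero of `∂ₜ^j (u · ∇ u)`, where `u i` stands for `∂ₜ^i u` at time zero. -/
noncomputable def advJet (Ω : Set E3) (u : ℕ → E3 → E3) (j : ℕ) (x : E3) : E3 :=
  ∑ i ∈ Finset.range (j + 1), (j.choose i : ℝ) • adv (closure Ω) (u i) (u (j - i)) x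

/-- The value at time zero of `∂ₜ^j (∇u · (∇u)ᵀ)`, where `u i` stands for `∂ₜ^i u` at time
zero. -/
noncomputable def gradDotJet (Ω : Set E3) (u : ℕ → E3 → E3) (j : ℕ) (x : E3) : ℝ :=
  ∑ i ∈ Finset.range (j + 1), (j.choose i : ℝ) * gradDot (closure Ω) (u i) (u (j - i)) x

/-- The formal time derivatives at time zero, `u j` of the velocity and `p j` of the pressure,
`0 ≤ j ≤ N`, as determined inductively by the data: `u 0 = u₀`; `p j` is the mean-zero solution
of the `j`-th time derivative of the Neumann problem
`Δ p = - ∇u · (∇u)ᵀ` in `Ω`, `∇p · n = - ∂ₜ U^n - (u · ∇ u) · n` on the boundary;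
and `u (j + 1)` is given by the `j`-th time derivative of `∂ₜ u = - u · ∇ u - ∇ p + f`. -/
structure IsInitialJet (N : ℕ) (α : ℝ) (Ω : Set E3) (n : E3 → E3)
    (U f : ℝ → E3 → E3) (u₀ : E3 → E3) (u : ℕ → E3 → E3) (p : ℕ → E3 → ℝ) : Prop where
  u_zero : ∀ x ∈ closure Ω, u 0 x = u₀ x
  u_succ : ∀ j < N, ∀ x ∈ closure Ω,
    u (j + 1) x =
      -advJet Ω u j x - gradientWithin (p j) (closure Ω) x + timeDeriv j (fun t => f t x)
  p_holder : ∀ j ≤ N, HolderOn (N + 1 - j) α (closure Ω) (p j)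
  p_contDiffOn : ∀ j ≤ N, ContDiffOn ℝ 2 (p j) Ω
  p_laplacian : ∀ j ≤ N, ∀ x ∈ Ω, Laplacian.laplacian (p j) x = -gradDotJet Ω u j x
  p_neumann : ∀ j ≤ N, ∀ x ∈ frontier Ω,
    ⟪gradientWithin (p j) (closure Ω) x, n x⟫ =
      -timeDeriv (j + 1) (fun t => normalVel n U t x) - ⟪advJet Ω u j x, n x⟫
  p_mean_zero : ∀ j ≤ N, ∫ x in Ω, p j x = 0

/-- The equation `∂ₜ^{j+1} 𝒰^τ + ∂ₜ^j [u · ∇ u + ∇ p - f]^τ = 0` on `Γp` at time zero. -/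
def CondEq (Ω : Set E3) (n : E3 → E3) (Γp : Set E3) (U f : ℝ → E3 → E3)
    (u : ℕ → E3 → E3) (p : ℕ → E3 → ℝ) (j : ℕ) : Prop :=
  ∀ x ∈ Γp,
    timeDeriv (j + 1) (fun t => tang (n x) (U t x)) +
      tang (n x) (advJet Ω u j x + gradientWithin (p j) (closure Ω) x
        - timeDeriv j (fun t => f t x)) = 0

/-- The `N`-th compatibility condition `cond_N`. -/
def Cond (Ω : Set E3) (n : E3 → E3) (Γp : Set E3) (U f : ℝ → E3 → E3)
    (u : ℕ → E3 → E3) (p : ℕ → E3 → ℝ) : ℕ → Prop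
  | 0 => CondEq Ω n Γp U f u p 0
  | N + 1 => Cond Ω n Γp U f u p N ∧ CondEq Ω n Γp U f u p (N + 1)

/-- The value at time zero of `∂ₜ^j ω^τ` at a boundary point, where `ω = curl u`. -/
noncomputable def vortTang (Ω : Set E3) (n : E3 → E3) (u : ℕ → E3 → E3) (j : ℕ) (x : E3) : E3 :=
  tang (n x) (curl (closure Ω) (u j) x)

end EulerInflow

open EulerInflow

namespace EulerInflow

/-! The conditions are treated one order at a time. If those below order `j` hold, the evolution
equation makes the tangential part of each formal velocity derivative up to order `j` vanish on the
inflow boundary. The Neumann condition fixes the normal part. So there `u i` is `∂ₜ^i U^n` times the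
normal, with a coefficient constant along `Γp` (`IsInitialJet.eq_smul_normal`).

A field of constant length along the normal has tangential derivatives orthogonal to the normal, and
then the tangential part of its normal derivative is purely antisymmetric, hence given by the curl
(`tang_fderivWithin_smul_normal`). The advection term thus becomes the vorticity sum
(`IsInitialJet.tang_advJet`), and the tangential pressure gradient is the surface gradient
(`surfaceGradient_eq_tang`). This gives the equivalence at order `j`, and strong induction assembles
the orders. -/

lemma eventually_neg_of_hasDerivAt_neg {g : ℝ → ℝ} {a : ℝ} (hg : HasDerivAt g a 0)
    (h0 : g 0 = 0) (ha : a < 0) : ∀ᶠ t in 𝓝[>] (0 : ℝ), g t < 0 := by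
  have h1 : Tendsto (slope g 0) (𝓝[>] 0) (𝓝 a) :=
    (hasDerivAt_iff_tendsto_slope.1 hg).mono_left
      (nhdsWithin_mono _ fun t (ht : 0 < t) => ht.ne')
  filter_upwards [h1.eventually (gt_mem_nhds ha), self_mem_nhdsWithin] with t ht ht0
  rw [slope_def_field, h0, sub_zero, sub_zero] at ht
  by_contra hc
  exact absurd ht (not_lt.2 (div_nonneg (not_lt.1 hc) (le_of_lt ht0)))

/-! ### Local geometry of the boundary -/

namespace IsLocalDefiningFunction

variable {Ω V : Set E3} {ρ : E3 → ℝ} {x : E3}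

lemma contDiffAt (h : IsLocalDefiningFunction Ω V ρ) (hx : x ∈ V) : ContDiffAt ℝ 1 ρ x :=
  h.contDiffOn.contDiffAt (h.isOpen.mem_nhds hx)

lemma differentiableAt (h : IsLocalDefiningFunction Ω V ρ) (hx : x ∈ V) :
    DifferentiableAt ℝ ρ x :=
  (h.contDiffAt hx).differentiableAt one_ne_zero

lemma mem_iff (h : IsLocalDefiningFunction Ω V ρ) (hx : x ∈ V) : x ∈ Ω ↔ ρ x < 0 := by
  have h1 : x ∈ Ω ∩ V ↔ x ∈ {y ∈ V | ρ y < 0} := by rw [h.eq_neg]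
  simpa [hx] using h1

lemma eq_zero_of_mem_frontier (h : IsLocalDefiningFunction Ω V ρ) (hΩ : IsOpen Ω) (hx : x ∈ V)
    (hxf : x ∈ frontier Ω) : ρ x = 0 := by
  rw [hΩ.frontier_eq] at hxf
  refine le_antisymm ?_ (not_lt.1 fun hlt => hxf.2 ((h.mem_iff hx).2 hlt))
  by_contra! hc
  have h1 : ∀ᶠ y in 𝓝 x, y ∈ V ∧ 0 < ρ y :=
    (h.isOpen.eventually_mem hx).and
      ((h.differentiableAt hx).continuousAt.eventually (lt_mem_nhds hc))
  obtain ⟨y, hy, hyΩ⟩ := mem_closure_iff_nhds.1 hxf.1 _ h1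
  exact absurd ((h.mem_iff hy.1).1 hyΩ) (not_lt.2 hy.2.le)

lemma hasDerivAt_comp (h : IsLocalDefiningFunction Ω V ρ) {c : ℝ → E3} {c' : E3}
    (hx : c 0 ∈ V) (hc : HasDerivAt c c' 0) :
    HasDerivAt (fun t => ρ (c t)) ⟪gradient ρ (c 0), c'⟫ 0 := by
  have h1 := (h.differentiableAt hx).hasFDerivAt.comp_hasDerivAt 0 hc
  rwa [← inner_gradient_left] at h1

lemma eventually_mem_of_inner_neg (h : IsLocalDefiningFunction Ω V ρ) (hx : x ∈ V)
    (h0 : ρ x = 0) {v : E3} (hv : ⟪gradient ρ x, v⟫ < 0) :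
    ∀ᶠ t : ℝ in 𝓝[>] 0, x + t • v ∈ Ω := by
  have hc : HasDerivAt (fun t : ℝ => x + t • v) v 0 := by
    simpa using ((hasDerivAt_id (0 : ℝ)).smul_const v).const_add x
  have hV : ∀ᶠ t : ℝ in 𝓝 0, x + t • v ∈ V :=
    hc.continuousAt.eventually (h.isOpen.eventually_mem (by simpa using hx))
  have h1 := h.hasDerivAt_comp (c := fun t : ℝ => x + t • v) (by simpa using hx) hc
  simp only [zero_smul, add_zero] at h1
  filter_upwards [eventually_neg_of_hasDerivAt_neg h1 (by simpa using h0) hv,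
    hV.filter_mono nhdsWithin_le_nhds] with t ht htV
  exact (h.mem_iff htV).2 ht

lemma mem_frontier_of_eq_zero (h : IsLocalDefiningFunction Ω V ρ) (hΩ : IsOpen Ω) (hx : x ∈ V)
    (h0 : ρ x = 0) : x ∈ frontier Ω := by
  rw [hΩ.frontier_eq]
  refine ⟨?_, fun hm => absurd ((h.mem_iff hx).1 hm) (by simp [h0])⟩
  have h1 : ⟪gradient ρ x, -gradient ρ x⟫ < 0 := by
    rw [inner_neg_right, neg_lt_zero]
    exact real_inner_self_pos.2 (h.grad_ne_zero x hx)
  have h2 : Tendsto (fun t : ℝ => x + t • (-gradient ρ x)) (𝓝[>] 0) (𝓝 x) := by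
    have : ContinuousAt (fun t : ℝ => x + t • (-gradient ρ x)) 0 := by fun_prop
    simpa [ContinuousAt] using this.tendsto.mono_left nhdsWithin_le_nhds
  exact mem_closure_of_tendsto h2 (h.eventually_mem_of_inner_neg hx h0 h1)

/-- The tangent cone contains the open half-space of directions along which `ρ` decreases; being
open and nonempty, it spans the whole space. -/
lemma uniqueDiffWithinAt (h : IsLocalDefiningFunction Ω V ρ) (hx : x ∈ V)
    (h0 : ρ x = 0) (hxc : x ∈ closure Ω) : UniqueDiffWithinAt ℝ Ω x := by
  refine ⟨?_, hxc⟩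
  have hsub : {v : E3 | ⟪gradient ρ x, v⟫ < 0} ⊆ tangentConeAt ℝ Ω x := by
    intro v hv
    refine mem_tangentConeAt_of_add_smul_mem (l := 𝓝[>] (0 : ℝ)) (c := fun t => t) ?_
      (h.eventually_mem_of_inner_neg hx h0 hv)
    exact tendsto_nhdsWithin_mono_right (fun t (ht : 0 < t) => ht.ne') tendsto_id
  have hopen : IsOpen {v : E3 | ⟪gradient ρ x, v⟫ < 0} :=
    isOpen_lt (by fun_prop) continuous_const
  have htop : Submodule.span ℝ (tangentConeAt ℝ Ω x) = ⊤ := by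
    apply Submodule.eq_top_of_nonempty_interior'
    refine ⟨-gradient ρ x, mem_interior.2 ⟨_, hsub.trans Submodule.subset_span, hopen, ?_⟩⟩
    rw [mem_ofPred_eq, inner_neg_right, neg_lt_zero]
    exact real_inner_self_pos.2 (h.grad_ne_zero x hx)
  rw [htop]
  exact dense_univ

/-- Since the gradient is nonzero, the implicit function theorem parametrizes the level set of `ρ`
by the kernel of its derivative. The curve is the image of the line `s • τ` in that kernel. -/
lemma exists_curve (h : IsLocalDefiningFunction Ω V ρ) (hΩ : IsOpen Ω) (hx : x ∈ V)
    (h0 : ρ x = 0) {τ : E3} (hτ : ⟪gradient ρ x, τ⟫ = 0) :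
    ∃ c : ℝ → E3, c 0 = x ∧ (∀ᶠ s in 𝓝 0, c s ∈ frontier Ω) ∧ HasDerivAt c τ 0 := by
  have hs : HasStrictFDerivAt ρ (fderiv ℝ ρ x) x := (h.contDiffAt hx).hasStrictFDerivAt one_ne_zero
  have hsurj : (fderiv ℝ ρ x).range = ⊤ := by
    refine LinearMap.range_eq_top.2 (LinearMap.surjective fun hz => h.grad_ne_zero x hx ?_)
    refine ext_inner_right ℝ fun v => ?_
    rw [inner_gradient_left, inner_zero_left]
    exact congrArg (fun l : E3 →ₗ[ℝ] ℝ => l v) hz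
  have hker : τ ∈ (fderiv ℝ ρ x).ker := by
    rw [inner_gradient_left] at hτ
    exact hτ
  let w : (fderiv ℝ ρ x).ker := ⟨τ, hker⟩
  have hline : HasDerivAt (fun s : ℝ => s • w) w 0 := by
    simpa using (hasDerivAt_id (0 : ℝ)).smul_const w
  have hderiv : HasDerivAt (fun s : ℝ => hs.implicitFunction ρ _ hsurj (ρ x) (s • w)) τ 0 := by
    have h1 := (hs.to_implicitFunction hsurj).hasFDerivAt
    rw [← zero_smul ℝ w] at h1
    exact h1.comp_hasDerivAt 0 hline
  have hc0 : hs.implicitFunction ρ _ hsurj (ρ x) ((0 : ℝ) • w) = x := by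
    rw [zero_smul]; exact hs.implicitFunction_apply_image hsurj
  refine ⟨_, hc0, ?_, hderiv⟩
  have hV : ∀ᶠ s : ℝ in 𝓝 0, hs.implicitFunction ρ _ hsurj (ρ x) (s • w) ∈ V :=
    hderiv.continuousAt.eventually (h.isOpen.eventually_mem (by beta_reduce; rw [hc0]; exact hx))
  have hmap : ∀ᶠ s : ℝ in 𝓝 0, ρ (hs.implicitFunction ρ _ hsurj (ρ x) (s • w)) = ρ x := by
    have ht : Tendsto (fun s : ℝ => (ρ x, s • w)) (𝓝 0) (𝓝 (ρ x, 0)) := by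
      refine tendsto_const_nhds.prodMk_nhds ?_
      simpa using hline.continuousAt.tendsto
    exact ht.eventually (hs.map_implicitFunction_eq hsurj)
  filter_upwards [hV, hmap] with s hsV hsm
  exact h.mem_frontier_of_eq_zero hΩ hsV (hsm.trans h0)

end IsLocalDefiningFunction

/-! ### Normals, boundary curves and the surface gradient -/

section Normal

variable {Ω : Set E3} {x ν : E3}

lemma IsOutwardUnitNormal.norm_eq_one (h : IsOutwardUnitNormal Ω x ν) : ‖ν‖ = 1 := by
  obtain ⟨V, ρ, hx, hρ, rfl⟩ := h
  exact norm_smul_inv_norm (𝕜 := ℝ) (hρ.grad_ne_zero x hx)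

lemma IsOutwardUnitNormal.exists_curve (h : IsOutwardUnitNormal Ω x ν) (hΩ : IsOpen Ω)
    (hxf : x ∈ frontier Ω) {τ : E3} (hτ : ⟪ν, τ⟫ = 0) :
    ∃ c : ℝ → E3, c 0 = x ∧ (∀ᶠ s in 𝓝 0, c s ∈ frontier Ω) ∧ HasDerivAt c τ 0 := by
  obtain ⟨V, ρ, hx, hρ, rfl⟩ := h
  refine hρ.exists_curve hΩ hx (hρ.eq_zero_of_mem_frontier hΩ hx hxf) ?_
  rw [real_inner_smul_left] at hτ
  exact (mul_eq_zero.1 hτ).resolve_left (inv_ne_zero (norm_ne_zero_iff.2 (hρ.grad_ne_zero x hx)))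

lemma IsOutwardUnitNormal.inner_velocity (h : IsOutwardUnitNormal Ω x ν) (hΩ : IsOpen Ω)
    {c : ℝ → E3} {c' : E3} (h0 : c 0 = x) (hc : ∀ᶠ s in 𝓝 0, c s ∈ frontier Ω)
    (hd : HasDerivAt c c' 0) : ⟪ν, c'⟫ = 0 := by
  obtain ⟨V, ρ, hx, hρ, rfl⟩ := h
  subst h0
  have hV : ∀ᶠ s in 𝓝 0, c s ∈ V := hd.continuousAt.eventually (hρ.isOpen.eventually_mem hx)
  have hz : (fun s => ρ (c s)) =ᶠ[𝓝 0] fun _ => 0 := by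
    filter_upwards [hV, hc] with s h1 h2
    exact hρ.eq_zero_of_mem_frontier hΩ h1 h2
  rw [real_inner_smul_left,
    ((hρ.hasDerivAt_comp hx hd).congr_of_eventuallyEq hz.symm).unique (hasDerivAt_const _ _),
    mul_zero]

lemma HasHolderBoundary.uniqueDiffOn_closure {k : ℕ} {α : ℝ} (h : HasHolderBoundary k α Ω)
    (hΩ : IsOpen Ω) : UniqueDiffOn ℝ (closure Ω) := by
  intro x hx
  refine UniqueDiffWithinAt.closure ?_
  by_cases hxΩ : x ∈ Ω
  · exact hΩ.uniqueDiffWithinAt hxΩ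
  · have hxf : x ∈ frontier Ω := by rw [hΩ.frontier_eq]; exact ⟨hx, hxΩ⟩
    obtain ⟨V, ρ, hxV, hρ, -⟩ := h x hxf
    exact hρ.uniqueDiffWithinAt hxV (hρ.eq_zero_of_mem_frontier hΩ hxV hxf) hx

/-- A two-sided derivative results from one-sided regularity of `φ`, because the curve stays in `s`
for both signs of the parameter. -/
lemma hasDerivAt_comp_curve {G : Type*} [NormedAddCommGroup G] [NormedSpace ℝ G] {s : Set E3}
    {φ : E3 → G} {c : ℝ → E3} {c' : E3} (hφ : DifferentiableWithinAt ℝ φ s (c 0))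
    (hc : ∀ᶠ r in 𝓝 0, c r ∈ s) (hd : HasDerivAt c c' 0) :
    HasDerivAt (fun r => φ (c r)) (fderivWithin ℝ φ s (c 0) c') 0 := by
  have h1 : HasDerivWithinAt (φ ∘ c) (fderivWithin ℝ φ s (c 0) c') (c ⁻¹' s) 0 :=
    hφ.hasFDerivWithinAt.comp_hasDerivWithinAt 0 hd.hasDerivWithinAt (mapsTo_preimage c s)
  exact h1.hasDerivAt hc

lemma inner_tang_self (hν : ‖ν‖ = 1) (v : E3) : ⟪tang ν v, ν⟫ = 0 := by
  simp [tang, inner_sub_left, real_inner_smul_left, hν]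

lemma inner_tang_of_inner_eq_zero {τ : E3} (hτ : ⟪ν, τ⟫ = 0) (v : E3) :
    ⟪tang ν v, τ⟫ = ⟪v, τ⟫ := by
  simp [tang, inner_sub_left, real_inner_smul_left, hτ]

/-- Velocities of boundary curves are orthogonal to `ν`, so the tangential projection qualifies.
Every tangent vector is such a velocity; testing with the difference of two candidates gives
uniqueness. -/
lemma surfaceGradient_eq_tang (h : IsOutwardUnitNormal Ω x ν) (hΩ : IsOpen Ω)
    (hxf : x ∈ frontier Ω) {φ : E3 → ℝ} (hφ : DifferentiableWithinAt ℝ φ (closure Ω) x) :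
    surfaceGradient (frontier Ω) ν φ x = tang ν (gradientWithin φ (closure Ω) x) := by
  have hν := h.norm_eq_one
  have hex : HasSurfaceGradient (frontier Ω) ν φ x (tang ν (gradientWithin φ (closure Ω) x)) := by
    refine ⟨inner_tang_self hν _, fun c c' h0 hc hd => ?_⟩
    rw [inner_tang_of_inner_eq_zero (h.inner_velocity hΩ h0 hc hd), inner_gradientWithin_left]
    subst h0
    exact hasDerivAt_comp_curve hφ (hc.mono fun s hs => frontier_subset_closure hs) hd
  have huniq : ∀ g g', HasSurfaceGradient (frontier Ω) ν φ x g →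
      HasSurfaceGradient (frontier Ω) ν φ x g' → g = g' := by
    intro g g' hg hg'
    have hτ : ⟪ν, g - g'⟫ = 0 := by
      rw [real_inner_comm, inner_sub_left, hg.1, hg'.1, sub_zero]
    obtain ⟨c, h0, hc, hd⟩ := h.exists_curve hΩ hxf hτ
    have h1 := (hg.2 c _ h0 hc hd).unique (hg'.2 c _ h0 hc hd)
    rw [← sub_eq_zero, ← inner_sub_left] at h1
    exact sub_eq_zero.1 (inner_self_eq_zero.1 h1)
  have hex' : ∃ g, HasSurfaceGradient (frontier Ω) ν φ x g := ⟨_, hex⟩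
  rw [surfaceGradient, dif_pos hex']
  exact huniq _ _ hex'.choose_spec hex

end Normal

end EulerInflow

namespace EulerInflow

/-! ### Time derivatives at zero and regularity of the spatial operators -/

section TimeDeriv

variable {G H : Type*} [NormedAddCommGroup G] [NormedSpace ℝ G]
  [NormedAddCommGroup H] [NormedSpace ℝ H]

lemma timeDeriv_congr {g h : ℝ → G} (j : ℕ) (hgh : ∀ t, 0 ≤ t → g t = h t) :
    timeDeriv j g = timeDeriv j h :=
  iteratedDerivWithin_congr (fun t ht => hgh t ht) self_mem_Ici

lemma timeDeriv_eq_zero {g : ℝ → G} (j : ℕ) (hg : ∀ t, 0 ≤ t → g t = 0) : timeDeriv j g = 0 :=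
  (timeDeriv_congr j hg).trans iteratedDerivWithin_fun_const_zero

lemma timeDeriv_clm_apply (L : G →L[ℝ] H) {g : ℝ → G} {j : ℕ}
    (hg : ContDiffWithinAt ℝ j g (Ici 0) 0) :
    timeDeriv j (fun t => L (g t)) = L (timeDeriv j g) := by
  simp only [timeDeriv, iteratedDerivWithin_eq_iteratedFDerivWithin]
  exact congrArg (fun M => M fun _ => (1 : ℝ))
    (L.iteratedFDerivWithin_comp_left hg (uniqueDiffOn_Ici 0) self_mem_Ici le_rfl)

lemma contDiffOn_slice {s : Set E3} {F : ℝ → E3 → G} {m : WithTop ℕ∞}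
    (hF : ContDiffOn ℝ m (Function.uncurry F) (Ici (0 : ℝ) ×ˢ s)) {x : E3} (hx : x ∈ s) :
    ContDiffOn ℝ m (fun t => F t x) (Ici 0) :=
  hF.comp (f := fun t => (t, x)) (by fun_prop) fun _ ht => ⟨ht, hx⟩

/-- A time derivative is the joint derivative in direction `(1, 0)`, which costs one joint order;
hence the induction over all `F`. -/
lemma contDiffOn_timeDeriv {s : Set E3} (hs : UniqueDiffOn ℝ s) (j k : ℕ) (F : ℝ → E3 → G)
    (hF : ContDiffOn ℝ (j + k : ℕ) (Function.uncurry F) (Ici (0 : ℝ) ×ˢ s)) :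
    ContDiffOn ℝ k (fun x => timeDeriv j (fun t => F t x)) s := by
  induction j generalizing F with
  | zero =>
    simp only [timeDeriv, iteratedDerivWithin_zero]
    rw [zero_add] at hF
    exact hF.comp (f := fun x : E3 => ((0 : ℝ), x)) (by fun_prop) fun x hx => ⟨self_mem_Ici, hx⟩
  | succ j ih =>
    set S := Ici (0 : ℝ) ×ˢ s
    have hS : UniqueDiffOn ℝ S := (uniqueDiffOn_Ici 0).prod hs
    have hG : ContDiffOn ℝ (j + k : ℕ) (Function.uncurry fun (t : ℝ) (x : E3) =>
        fderivWithin ℝ (Function.uncurry F) S (t, x) ((1 : ℝ), (0 : E3))) S :=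
      (hF.fderivWithin hS (by norm_cast; omega)).clm_apply contDiffOn_const
    refine (ih _ hG).congr fun x hx => ?_
    rw [timeDeriv, iteratedDerivWithin_succ']
    refine timeDeriv_congr j fun t ht => ?_
    have hd : DifferentiableWithinAt ℝ (Function.uncurry F) S (t, x) :=
      hF.differentiableOn (by norm_cast; omega) _ ⟨ht, hx⟩
    have hl : HasDerivWithinAt (fun r : ℝ => (r, x)) ((1 : ℝ), (0 : E3)) (Ici 0) t :=
      (hasDerivWithinAt_id _ _).prodMk (hasDerivWithinAt_const _ _ _)
    have hm : MapsTo (fun r : ℝ => (r, x)) (Ici 0) S := fun r hr => ⟨hr, hx⟩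
    exact (hd.hasFDerivWithinAt.comp_hasDerivWithinAt t hl hm).derivWithin
      (uniqueDiffOn_Ici 0 t ht)

end TimeDeriv

lemma contDiffOn_gradientWithin {s : Set E3} (hs : UniqueDiffOn ℝ s) {φ : E3 → ℝ}
    {m k : WithTop ℕ∞} (hφ : ContDiffOn ℝ k φ s) (hmk : m + 1 ≤ k) :
    ContDiffOn ℝ m (gradientWithin φ s) s := by
  rw [contDiffOn_euclidean]
  intro i
  refine ((hφ.fderivWithin hs hmk).clm_apply
    (contDiffOn_const (c := basisVec i))).congr fun x _ => ?_
  rw [← inner_gradientWithin_left, basisVec, EuclideanSpace.inner_single_right]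
  simp

lemma contDiffOn_adv {s : Set E3} (hs : UniqueDiffOn ℝ s) {v w : E3 → E3}
    {m k : WithTop ℕ∞} (hv : ContDiffOn ℝ m v s) (hw : ContDiffOn ℝ k w s) (hmk : m + 1 ≤ k) :
    ContDiffOn ℝ m (adv s v w) s :=
  (hw.fderivWithin hs hmk).clm_apply hv

/-! ### Regularity and boundary values of the formal time derivatives -/

section Jet

variable {N : ℕ} {α : ℝ} {Ω : Set E3} {n : E3 → E3} {Γp Γm Γ0 : Set E3}
  {U f : ℝ → E3 → E3} {u₀ : E3 → E3} {u : ℕ → E3 → E3} {p : ℕ → E3 → ℝ}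

lemma HasRegularity.uniqueDiffOn_closure (hdata : HasRegularity N α Ω n Γp Γm Γ0 U f u₀) :
    UniqueDiffOn ℝ (closure Ω) :=
  hdata.boundary.uniqueDiffOn_closure hdata.domain.isOpen

/-- Each time derivative costs one space derivative. For `k ≤ N` at least `C¹` remains, so the
first-order derivatives in the advection terms and the vorticity make sense up to the boundary. -/
lemma IsInitialJet.contDiffOn (hdata : HasRegularity N α Ω n Γp Γm Γ0 U f u₀)
    (hjet : IsInitialJet N α Ω n U f u₀ u p) {k : ℕ} (hk : k ≤ N) :
    ContDiffOn ℝ (N + 1 - k : ℕ) (u k) (closure Ω) := by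
  have hs := hdata.uniqueDiffOn_closure
  induction k using Nat.strong_induction_on with
  | _ k ih =>
    rcases k with _ | j
    · exact hdata.u₀_holder.1.congr hjet.u_zero
    · have hN : N + 1 - (j + 1) = N - j := by omega
      rw [hN]
      refine ContDiffOn.congr ?_ (hjet.u_succ j hk)
      refine ((ContDiffOn.sum fun i hi => ContDiffOn.const_smul _ ?_).neg.sub
        (contDiffOn_gradientWithin hs (hjet.p_holder j (by omega)).1 ?_)).add
        (contDiffOn_timeDeriv hs j (N - j) f (hdata.f_holder.1.of_le ?_))
      · have hi' := Finset.mem_range.1 hi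
        exact contDiffOn_adv hs
          ((ih i (by omega) (by omega)).of_le (by norm_cast; omega))
          (ih (j - i) (by omega) (by omega)) (by norm_cast; omega)
      · norm_cast; omega
      · norm_cast; omega

lemma IsInitialJet.differentiableWithinAt (hdata : HasRegularity N α Ω n Γp Γm Γ0 U f u₀)
    (hjet : IsInitialJet N α Ω n U f u₀ u p) {k : ℕ} (hk : k ≤ N) {x : E3}
    (hx : x ∈ closure Ω) : DifferentiableWithinAt ℝ (u k) (closure Ω) x :=
  (hjet.contDiffOn hdata hk).differentiableOn (by norm_cast; omega) x hx

lemma HasRegularity.contDiffWithinAt_force (hdata : HasRegularity N α Ω n Γp Γm Γ0 U f u₀)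
    {j : ℕ} (hj : j ≤ N) {x : E3} (hx : x ∈ closure Ω) :
    ContDiffWithinAt ℝ j (fun t => f t x) (Ici 0) 0 :=
  ((contDiffOn_slice hdata.f_holder.1 hx).of_le (by norm_cast; omega)) 0 self_mem_Ici

lemma HasRegularity.inner_timeDeriv_force (hdata : HasRegularity N α Ω n Γp Γm Γ0 U f u₀)
    {j : ℕ} (hj : j ≤ N) {x : E3} (hx : x ∈ frontier Ω) :
    ⟪timeDeriv j (fun t => f t x), n x⟫ = 0 := by
  rw [real_inner_comm, ← innerSL_apply_apply ℝ, ← timeDeriv_clm_apply _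
    (hdata.contDiffWithinAt_force hj (frontier_subset_closure hx))]
  refine timeDeriv_eq_zero j fun t ht => ?_
  rw [innerSL_apply_apply, real_inner_comm]
  exact (hdata.f_H0 t ht).tangent x hx

/-- The normal component of the formal time derivatives of the velocity on the boundary. -/
lemma IsInitialJet.inner_normal (hdata : HasRegularity N α Ω n Γp Γm Γ0 U f u₀)
    (hjet : IsInitialJet N α Ω n U f u₀ u p) {k : ℕ} (hk : k ≤ N) {x : E3}
    (hx : x ∈ frontier Ω) :
    ⟪u k x, n x⟫ = timeDeriv k (fun t => normalVel n U t x) := by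
  have hxc := frontier_subset_closure hx
  rcases k with _ | j
  · rw [hjet.u_zero x hxc, hdata.u₀_normal x hx]
    simp [timeDeriv]
  -- The Neumann data cancel the normal advection term, and the force is tangent to the boundary.
  · rw [hjet.u_succ j hk x hxc, inner_add_left, inner_sub_left, inner_neg_left,
      hjet.p_neumann j (by omega) x hx, hdata.inner_timeDeriv_force (by omega) hx]
    ring

/-- The linear projection onto the plane orthogonal to `ν`. -/
noncomputable def tangL (ν : E3) : E3 →L[ℝ] E3 :=
  ContinuousLinearMap.id ℝ E3 - (innerSL ℝ ν).smulRight ν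

lemma tangL_apply (ν v : E3) : tangL ν v = tang ν v := by
  simp [tangL, tang, real_inner_comm]

/-- Once the condition holds at a given order, the next formal time derivative of the velocity is
normal on the inflow boundary. -/
lemma IsInitialJet.tang_succ_eq_zero (hjet : IsInitialJet N α Ω n U f u₀ u p)
    (hΓ : Γp ⊆ closure Ω) (hUtang : ∀ t, 0 ≤ t → ∀ x ∈ Γp, tang (n x) (U t x) = 0)
    {j : ℕ} (hj : j < N) (hc : CondEq Ω n Γp U f u p j) {x : E3} (hx : x ∈ Γp) :
    tang (n x) (u (j + 1) x) = 0 := by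
  have h1 := hc x hx
  rw [timeDeriv_eq_zero _ (fun t ht => hUtang t ht x hx), zero_add, ← tangL_apply] at h1
  have h2 : u (j + 1) x = -(advJet Ω u j x + gradientWithin (p j) (closure Ω) x
      - timeDeriv j (fun t => f t x)) := by
    rw [hjet.u_succ j hj x (hΓ hx)]; abel
  rw [h2, ← tangL_apply, map_neg, h1, neg_zero]

end Jet

end EulerInflow

namespace EulerInflow

/-! ### Normal derivative and vorticity -/

lemma perp_tang (ν w : E3) : perp ν (tang ν w) = cross ν w := by
  simp only [perp, cross, tang]
  congr 1
  simp [cross_self]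

/-- If `∇v` maps tangent vectors to tangent vectors, then the tangential part of the normal
derivative of `v` is the rotated tangential vorticity. -/
lemma tang_fderivWithin_smul_normal {s : Set E3} {v : E3 → E3} {x ν : E3} (hν : ‖ν‖ = 1)
    (h : ∀ τ, ⟪ν, τ⟫ = 0 → ⟪ν, fderivWithin ℝ v s x τ⟫ = 0) (a : ℝ) :
    tang ν (fderivWithin ℝ v s x (a • ν)) = -(a • perp ν (tang ν (curl s v x))) := by
  set D := fderivWithin ℝ v s x with hD
  have hνν : ⟪ν, ν⟫ = 1 := by rw [real_inner_self_eq_norm_sq, hν, one_pow]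
  set l := ⟪D ν, ν⟫ with hl
  -- The transpose of `D` has `ν` as an eigenvector: test `h` on the tangential part of each basis
  -- vector.
  have hcol : ∀ i, ⟪ν, D (basisVec i)⟫ = l * ν i := by
    intro i
    have hb : ⟪ν, basisVec i⟫ = ν i := by simp [basisVec, EuclideanSpace.inner_single_right]
    have h1 := h (basisVec i - ν i • ν) (by
      rw [inner_sub_right, real_inner_smul_right, hνν, hb]; ring)
    rw [map_sub, map_smul, inner_sub_right, real_inner_smul_right, real_inner_comm (D ν)] at h1
    linarith
  have hsum : ν = ∑ i, ν i • basisVec i := by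
    ext k
    fin_cases k <;> simp [basisVec, Fin.sum_univ_three]
  have hDν : ∀ k, (D ν) k = ∑ i, ν i * (D (basisVec i)) k := by
    intro k
    conv_lhs => rw [hsum]
    simp [map_sum]
  have hinner : ∀ w : E3, ⟪ν, w⟫ = ν 0 * w 0 + ν 1 * w 1 + ν 2 * w 2 := by
    intro w
    simp [PiLp.inner_apply, Fin.sum_univ_three, mul_comm]
  rw [perp_tang, map_smul, ← tangL_apply, map_smul, ← smul_neg]
  congr 1
  rw [tangL_apply, tang, ← hl]
  have h0 := hcol 0
  have h1 := hcol 1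
  have h2 := hcol 2
  rw [hinner] at h0 h1 h2
  -- By `hcol`, the `k`-th component on the left is `∑ᵢ νᵢ (∂ᵢ vₖ - ∂ₖ vᵢ)`, which is that of `curl
  -- v × ν`.
  ext k
  fin_cases k <;>
    simp only [cross, curl, pd, ← hD, PiLp.sub_apply, PiLp.neg_apply, PiLp.smul_apply, smul_eq_mul,
      hDν, Fin.sum_univ_three, crossProduct, LinearMap.mk₂_apply] <;>
    simp <;> linarith

/-- The gradient of a field that is a constant multiple of the normal on `Γp` maps tangent vectors
to tangent vectors. -/
lemma IsInflowDomain.inner_normal_fderivWithin_eq_zero {Ω : Set E3} {n : E3 → E3}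
    {Γp Γm Γ0 : Set E3} (hdom : IsInflowDomain Ω n Γp Γm Γ0) {v : E3 → E3} {b : ℝ}
    (hv : ∀ y ∈ Γp, v y = b • n y) {x : E3} (hx : x ∈ Γp)
    (hd : DifferentiableWithinAt ℝ v (closure Ω) x) {τ : E3} (hτ : ⟪n x, τ⟫ = 0) :
    ⟪n x, fderivWithin ℝ v (closure Ω) x τ⟫ = 0 := by
  have hsub : Γp ⊆ frontier Ω := by
    rw [← hdom.union_eq]; exact subset_union_left.trans subset_union_left
  obtain ⟨c, h0, hc, hcd⟩ :=
    (hdom.normal x (hsub hx)).exists_curve hdom.isOpen (hsub hx) hτ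
  -- The other two boundary parts are closed and miss `x`, so the curve avoids them for small
  -- parameters.
  have hcp : ∀ᶠ r in 𝓝 0, c r ∈ Γp := by
    have hm : ∀ᶠ r in 𝓝 0, c r ∉ Γm ∪ Γ0 :=
      hcd.continuousAt.eventually
        ((hdom.isClosed_m.union hdom.isClosed_0).isOpen_compl.eventually_mem (by
          rw [h0]
          rintro (h | h)
          · exact disjoint_left.1 hdom.disjoint_pm hx h
          · exact disjoint_left.1 hdom.disjoint_p0 hx h))
    filter_upwards [hm, hc] with r h1 h2
    rw [← hdom.union_eq, union_assoc] at h2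
    exact h2.resolve_right h1
  have hderiv : HasDerivAt (fun r => v (c r)) (fderivWithin ℝ v (closure Ω) x τ) 0 := by
    subst h0
    exact hasDerivAt_comp_curve hd (hc.mono fun r hr => frontier_subset_closure hr) hcd
  -- For `b ≠ 0`, differentiating the constant `‖v‖² = b²` along the curve and dividing by `2b`
  -- avoids differentiating `n`.
  by_cases hb : b = 0
  · have hz : (fun r => v (c r)) =ᶠ[𝓝 0] fun _ => 0 := by
      filter_upwards [hcp] with r hr
      rw [hv _ hr, hb, zero_smul]
    rw [(hderiv.congr_of_eventuallyEq hz.symm).unique (hasDerivAt_const _ _), inner_zero_right]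
  · have hz : (fun r => ⟪v (c r), v (c r)⟫) =ᶠ[𝓝 0] fun _ => b * b := by
      filter_upwards [hcp] with r hr
      rw [hv _ hr, real_inner_smul_left, real_inner_smul_right, real_inner_self_eq_norm_sq,
        (hdom.normal _ (hsub hr)).norm_eq_one]
      ring
    have h1 := ((hderiv.inner ℝ hderiv).congr_of_eventuallyEq hz.symm).unique
      (hasDerivAt_const _ _)
    rw [h0, hv x hx, real_inner_comm, ← two_mul, real_inner_smul_right, real_inner_comm] at h1
    simpa [hb] using h1

lemma Cond_iff {Ω : Set E3} {n : E3 → E3} {Γp : Set E3} {U f : ℝ → E3 → E3}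
    {u : ℕ → E3 → E3} {p : ℕ → E3 → ℝ} (N : ℕ) :
    Cond Ω n Γp U f u p N ↔ ∀ j ≤ N, CondEq Ω n Γp U f u p j := by
  induction N with
  | zero => simp [Cond]
  | succ N ih =>
    rw [Cond, ih]
    refine ⟨fun h j hj => ?_, fun h => ⟨fun j hj => h j (by omega), h _ le_rfl⟩⟩
    rcases Nat.le_succ_iff.1 hj with hj | rfl
    · exact h.1 j hj
    · exact h.2

/-! ### The compatibility condition at each order -/

section Main

variable {N : ℕ} {α : ℝ} {Ω : Set E3} {n : E3 → E3} {Γp Γm Γ0 : Set E3}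
  {U f : ℝ → E3 → E3} {u₀ : E3 → E3} {u : ℕ → E3 → E3} {p : ℕ → E3 → ℝ}

lemma HasRegularity.inflow_subset_frontier (hdata : HasRegularity N α Ω n Γp Γm Γ0 U f u₀) :
    Γp ⊆ frontier Ω := by
  rw [← hdata.domain.union_eq]
  exact subset_union_left.trans subset_union_left

lemma IsInitialJet.eq_smul_normal (hdata : HasRegularity N α Ω n Γp Γm Γ0 U f u₀)
    (hjet : IsInitialJet N α Ω n U f u₀ u p)
    (hUtang : ∀ t, 0 ≤ t → ∀ x ∈ Γp, tang (n x) (U t x) = 0)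
    {k : ℕ} (hk : k ≤ N) (hc : ∀ i < k, CondEq Ω n Γp U f u p i) {x : E3} (hx : x ∈ Γp) :
    u k x = timeDeriv k (fun t => normalVel n U t x) • n x := by
  have hΓ := hdata.inflow_subset_frontier
  have hΓc := hΓ.trans frontier_subset_closure
  have htang : tang (n x) (u k x) = 0 := by
    rcases k with _ | j
    · rw [hjet.u_zero x (hΓc hx), hdata.u₀_tang x hx, hUtang 0 le_rfl x hx]
    · exact hjet.tang_succ_eq_zero hΓc hUtang hk (hc j (Nat.lt_succ_self j)) hx
  rw [← hjet.inner_normal hdata hk (hΓ hx)]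
  exact sub_eq_zero.1 htang

/-- In each summand both factors have order at most `j`, so both are multiples of the normal on
`Γp`: the first makes the advection a normal derivative, the second allows that derivative to be
expressed by the curl. -/
lemma IsInitialJet.tang_advJet (hdata : HasRegularity N α Ω n Γp Γm Γ0 U f u₀)
    (hjet : IsInitialJet N α Ω n U f u₀ u p)
    (hUtang : ∀ t, 0 ≤ t → ∀ x ∈ Γp, tang (n x) (U t x) = 0)
    (hUconst : ∀ t, 0 ≤ t → ∃ c : ℝ, ∀ x ∈ Γp, normalVel n U t x = c)
    {j : ℕ} (hj : j ≤ N) (hc : ∀ i < j, CondEq Ω n Γp U f u p i) {x : E3} (hx : x ∈ Γp) :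
    tang (n x) (advJet Ω u j x) =
      -∑ i ∈ Finset.range (j + 1), (j.choose i : ℝ) • timeDeriv i (fun t => normalVel n U t x) •
        perp (n x) (vortTang Ω n u (j - i) x) := by
  have hxf := hdata.inflow_subset_frontier hx
  have hconst : ∀ i, ∀ y ∈ Γp, timeDeriv i (fun t => normalVel n U t y) =
      timeDeriv i (fun t => normalVel n U t x) := fun i y hy =>
    timeDeriv_congr i fun t ht => by
      obtain ⟨c, hc⟩ := hUconst t ht
      rw [hc y hy, hc x hx]
  rw [advJet, ← tangL_apply, map_sum, ← Finset.sum_neg_distrib]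
  refine Finset.sum_congr rfl fun i hi => ?_
  have hi' := Finset.mem_range.1 hi
  rw [map_smul, ← smul_neg, tangL_apply, adv,
    hjet.eq_smul_normal hdata hUtang (by omega) (fun l hl => hc l (by omega)) hx, vortTang]
  congr 1
  refine tang_fderivWithin_smul_normal (hdata.domain.normal x hxf).norm_eq_one (fun τ hτ => ?_) _
  refine hdata.domain.inner_normal_fderivWithin_eq_zero
    (b := timeDeriv (j - i) fun t => normalVel n U t x) (fun y hy => ?_) hx
    (hjet.differentiableWithinAt hdata (by omega) (frontier_subset_closure hxf)) hτ
  rw [hjet.eq_smul_normal hdata hUtang (by omega) (fun l hl => hc l (by omega)) hy,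
    hconst _ y hy]

lemma IsInitialJet.condEq_iff (hdata : HasRegularity N α Ω n Γp Γm Γ0 U f u₀)
    (hjet : IsInitialJet N α Ω n U f u₀ u p)
    (hUtang : ∀ t, 0 ≤ t → ∀ x ∈ Γp, tang (n x) (U t x) = 0)
    (hUconst : ∀ t, 0 ≤ t → ∃ c : ℝ, ∀ x ∈ Γp, normalVel n U t x = c)
    {j : ℕ} (hj : j ≤ N) (hc : ∀ i < j, CondEq Ω n Γp U f u p i) :
    CondEq Ω n Γp U f u p j ↔ ∀ x ∈ Γp,
      timeDeriv j (fun t => tang (n x) (f t x)) =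
        surfaceGradient (frontier Ω) (n x) (p j) x
          - ∑ i ∈ Finset.range (j + 1),
              (j.choose i : ℝ) • timeDeriv i (fun t => normalVel n U t x) •
                perp (n x) (vortTang Ω n u (j - i) x) := by
  refine forall₂_congr fun x hx => ?_
  have hxf := hdata.inflow_subset_frontier hx
  have hxc := frontier_subset_closure hxf
  have hp : DifferentiableWithinAt ℝ (p j) (closure Ω) x :=
    (hjet.p_holder j hj).1.differentiableOn (by norm_cast; omega) x hxc
  have hf : timeDeriv j (fun t => tang (n x) (f t x)) =
      tang (n x) (timeDeriv j fun t => f t x) := by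
    simp only [← tangL_apply]
    exact timeDeriv_clm_apply _ (hdata.contDiffWithinAt_force hj hxc)
  rw [timeDeriv_eq_zero _ (fun t ht => hUtang t ht x hx), zero_add,
    surfaceGradient_eq_tang (hdata.domain.normal x hxf) hdata.domain.isOpen hxf hp, hf,
    sub_eq_add_neg (tang _ _), ← hjet.tang_advJet hdata hUtang hUconst hj hc hx]
  simp only [← tangL_apply, map_add, map_sub]
  rw [sub_eq_zero, add_comm, eq_comm]

end Main

end EulerInflow

theorem propositionC1 (N : ℕ) (α : ℝ) (hα : 0 < α ∧ α < 1)
    (Ω : Set E3) (n : E3 → E3) (Γp Γm Γ0 : Set E3)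
    (U f : ℝ → E3 → E3) (u₀ : E3 → E3)
    (hdata : HasRegularity N α Ω n Γp Γm Γ0 U f u₀)
    (u : ℕ → E3 → E3) (p : ℕ → E3 → ℝ)
    (hjet : IsInitialJet N α Ω n U f u₀ u p)
    (hUtang : ∀ t, 0 ≤ t → ∀ x ∈ Γp, tang (n x) (U t x) = 0)
    (hUconst : ∀ t, 0 ≤ t → ∃ c : ℝ, ∀ x ∈ Γp, normalVel n U t x = c) :
    (Cond Ω n Γp U f u p N ↔
      ∀ j ≤ N, ∀ x ∈ Γp,
        timeDeriv j (fun t => tang (n x) (f t x)) =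
          surfaceGradient (frontier Ω) (n x) (p j) x
            - ∑ i ∈ Finset.range (j + 1),
                (j.choose i : ℝ) • timeDeriv i (fun t => normalVel n U t x) •
                  perp (n x) (vortTang Ω n u (j - i) x)) ∧
    ((∀ i, 1 ≤ i → i ≤ N → ∀ x ∈ Γp, timeDeriv i (fun t => normalVel n U t x) = 0) →
      (Cond Ω n Γp U f u p N ↔
        ∀ j ≤ N, ∀ x ∈ Γp,
          timeDeriv j (fun t => tang (n x) (f t x)) =
            surfaceGradient (frontier Ω) (n x) (p j) x
              - normalVel n U 0 x • perp (n x) (vortTang Ω n u j x))) := by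
  have key : Cond Ω n Γp U f u p N ↔
      ∀ j ≤ N, ∀ x ∈ Γp,
        timeDeriv j (fun t => tang (n x) (f t x)) =
          surfaceGradient (frontier Ω) (n x) (p j) x
            - ∑ i ∈ Finset.range (j + 1),
                (j.choose i : ℝ) • timeDeriv i (fun t => normalVel n U t x) •
                  perp (n x) (vortTang Ω n u (j - i) x) := by
    rw [Cond_iff]
    -- The forward direction has all lower conditions at hand; the converse must rebuild them by
    -- strong induction.
    refine ⟨fun h j hj => (hjet.condEq_iff hdata hUtang hUconst hj
      fun i hi => h i (by omega)).1 (h j hj), fun h j => ?_⟩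
    induction j using Nat.strong_induction_on with
    | _ j ih =>
      exact fun hj => (hjet.condEq_iff hdata hUtang hUconst hj
        fun i hi => ih i hi (by omega)).2 (h j hj)
  refine ⟨key, fun hzero => key.trans ?_⟩
  refine forall₂_congr fun j hj => forall₂_congr fun x hx => ?_
  -- Only the undifferentiated `U^n` survives.
  rw [Finset.sum_eq_single_of_mem 0 (by simp)]
  · simp [timeDeriv]
  · intro i hi hi0
    have hi' := Finset.mem_range.1 hi
    rw [hzero i (by omega) (by omega) x hx, zero_smul, smul_zero]
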